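/- Let $F$ be a free semigroup (the semigroup of nonempty words under concatenation) on a set with at least two elements, and let $L$ be a left ideal of $F$, i.e. a nonempty subset $L\subseteq F$ such that $fx\in L$ for all $f\in F$, $x\in L$; regard $L$ as a semigroup. For a semigroup $S$, an $S$-module is an abelian group $A$ with a left action of $S$ by additive endomorphisms such that $(xy)a=x(ya)$ (a left module over $\mathbf{Z}S$), and $H^n(S,A)$ $(n\ge 0)$ is the $n$-th cohomology group of the complex of groups $C^n(S,A)$ of all maps $f:S^n\to A$ with differential $$\partial^n f(x_1,\ldots,x_{n+1})=x_1f(x_2,\ldots,x_{n+1})+\sum_{i=1}^n(-1)^if(x_1,\ldots,x_ix_{i+1},\ldots,x_{n+1})+(-1)^{n+1}f(x_1,\ldots,x_n).$$ The cohomological dimension of $S$ is the largest $n$ such that $H^n(S,A)\neq 0$ for some $S$-module $A$ (and $\infty$ if there are arbitrarily large such $n$). Then $L$ has cohomological dimension $1$ if and only if $L$ is a free semigroup, i.e. isomorphic to the semigroup of nonempty words over some set. -/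

import Mathlib

universe u v

namespace SemigroupCohomology

/-- A left module over the integral semigroup ring of `S` (`S` need not have an identity) is an
abelian group `A` together with a multiplicative map `ρ` from `S` to the additive endomorphisms
of `A`; the element `s` acts on `a` as `ρ s a`. -/
abbrev Action (S : Type u) [Semigroup S] (A : Type v) [AddCommGroup A] : Type (max u v) :=
  S →ₙ* AddMonoid.End A

/-- The group of `n`-cochains: all maps from `S × ⋯ × S` (`n` times) to `A`. -/
abbrev Cochain (S : Type u) (A : Type v) (n : ℕ) : Type (max u v) :=
  (Fin n → S) → A

section

variable {S : Type u} [Semigroup S] {A : Type v} [AddCommGroup A] (ρ : Action S A)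

/-- The coboundary homomorphism
`∂f (x₁, …, xₙ₊₁) = x₁ f (x₂, …, xₙ₊₁) + ∑ᵢ (-1)ⁱ f (x₁, …, xᵢ xᵢ₊₁, …, xₙ₊₁)
  + (-1)ⁿ⁺¹ f (x₁, …, xₙ)`.
The index `j : Fin n` is `i - 1`, and `Fin.contractNth` multiplies two adjacent entries. -/
def coboundary (n : ℕ) : Cochain S A n →+ Cochain S A (n + 1) where
  toFun f x :=
    ρ (x 0) (f (Fin.tail x))
      + ∑ j : Fin n, (-1 : ℤ) ^ ((j : ℕ) + 1) • f (Fin.contractNth j.castSucc (· * ·) x)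
      + (-1 : ℤ) ^ (n + 1) • f (Fin.init x)
  map_zero' := by
    funext x
    simp
  map_add' f g := by
    funext x
    simp only [Pi.add_apply, map_add, smul_add, Finset.sum_add_distrib]
    abel

/-- The group of `n`-cocycles. -/
def cocycles (n : ℕ) : AddSubgroup (Cochain S A n) :=
  (coboundary ρ n).ker

/-- The group of `n`-coboundaries; it is zero for `n = 0`. -/
def coboundaries : (n : ℕ) → AddSubgroup (Cochain S A n)
  | 0 => ⊥
  | n + 1 => (coboundary ρ n).range

/-- The `n`-th cohomology group of `S` with coefficients in the module `A`: cocycles modulo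
coboundaries. -/
abbrev H (n : ℕ) : Type (max u v) :=
  cocycles ρ n ⧸ (coboundaries ρ n).addSubgroupOf (cocycles ρ n)

end

/-- The cohomological dimension of a semigroup `S`: the largest `n` for which some `S`-module has
a nonzero `n`-th cohomology group (`⊤` if there are arbitrarily large such `n`). -/
noncomputable def cohomologicalDimension (S : Type u) [Semigroup S] : ℕ∞ :=
  ⨆ n ∈ {n : ℕ | ∃ (A : Type u) (_ : AddCommGroup A) (ρ : Action S A), Nontrivial (H ρ n)},
    (n : ℕ∞)

/-- A semigroup is free if it is isomorphic to the semigroup of nonempty words over some set. -/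
def IsFree (S : Type u) [Semigroup S] : Prop :=
  ∃ X : Type u, Nonempty (S ≃* FreeSemigroup X)

end SemigroupCohomology

/-- A left ideal of a semigroup, regarded as a subsemigroup. -/
def SemigroupIdeal.toSubsemigroup {S : Type u} [Semigroup S] (L : SemigroupIdeal S) :
    Subsemigroup S where
  carrier := L
  mul_mem' {x _} _ hy := L.mul_mem x hy

/-! ### Cancellation and Levi's lemma for words. -/

namespace FreeSemigroup

variable {X : Type u}

/-! If `L` is free, every cocycle of degree at least 2 has a primitive defined by recursion on its
first argument (`coboundary_primitive`), while word length gives a nonzero class in degree 1.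
Conversely, let `H²` vanish and let `c y` be 1 or 0 according as `y` begins with a fixed letter or
not. The cocycle `(x, y) ↦ c y • [x]` in `ℤL` has a primitive; if `x, xu ∈ L` but `u ∉ L`, comparing
coefficients of `[xu]` in its equations at `(x, ut)` and `(xu, t)` makes `c` constant, which is
absurd. So `L` is left unitary (`mem_of_mul_mem`), and Levi's lemma makes factorization into
irreducibles of `L` unique. -/

theorem mul_left_cancel' {x y z : FreeSemigroup X} (h : x * y = x * z) : y = z := by
  have h' := congrArg FreeSemigroup.tail h
  simp only [tail_mul, List.append_cancel_left_eq, List.cons.injEq] at h'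
  exact FreeSemigroup.ext h'.1 h'.2

theorem of_mul_mk (a b : X) (l : List X) : of a * ⟨b, l⟩ = ⟨a, b :: l⟩ := rfl

theorem length_pos (x : FreeSemigroup X) : 0 < x.length := Nat.succ_pos _

/-- Levi's lemma for free semigroups. -/
theorem equidivisible {x y z t : FreeSemigroup X} (h : x * y = z * t) :
    x = z ∧ y = t ∨ (∃ u, z = x * u ∧ y = u * t) ∨ ∃ u, x = z * u ∧ t = u * y := by
  obtain ⟨x₁, x₂⟩ := x
  obtain ⟨y₁, y₂⟩ := y
  obtain ⟨z₁, z₂⟩ := z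
  obtain ⟨t₁, t₂⟩ := t
  have h₁ : x₁ = z₁ := congrArg FreeSemigroup.head h
  have h₂ : x₂ ++ y₁ :: y₂ = z₂ ++ t₁ :: t₂ := congrArg FreeSemigroup.tail h
  subst h₁
  rcases List.append_eq_append_iff.1 h₂ with ⟨l, rfl, h₃⟩ | ⟨l, rfl, h₃⟩
  · cases l with
    | nil =>
      left
      simpa using h₃
    | cons b l =>
      right; left
      refine ⟨⟨b, l⟩, rfl, ?_⟩
      simp only [List.cons_append, List.cons.injEq] at h₃
      exact FreeSemigroup.ext h₃.1 h₃.2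
  · cases l with
    | nil =>
      left
      simpa [eq_comm] using h₃
    | cons b l =>
      right; right
      refine ⟨⟨b, l⟩, rfl, ?_⟩
      simp only [List.cons_append, List.cons.injEq] at h₃
      exact FreeSemigroup.ext h₃.1 h₃.2

end FreeSemigroup

namespace SemigroupCohomology

/-! ### The coboundary and the first entry of a tuple. -/

section General

variable {S : Type u} [Semigroup S] {A : Type v} [AddCommGroup A] (ρ : Action S A)

theorem nontrivial_H_iff (n : ℕ) :
    Nontrivial (H ρ n) ↔ ¬ cocycles ρ n ≤ coboundaries ρ n := by
  rw [← not_subsingleton_iff_nontrivial, not_iff_not, QuotientAddGroup.subsingleton_iff,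
    AddSubgroup.addSubgroupOf_eq_top]

/-- Multiply the first entry of a tuple by `a` on the left. -/
def headMul {n : ℕ} (a : S) (x : Fin (n + 1) → S) : Fin (n + 1) → S :=
  Fin.cons (a * x 0) (Fin.tail x)

@[simp]
theorem headMul_zero {n : ℕ} (a : S) (x : Fin (n + 1) → S) : headMul a x 0 = a * x 0 := rfl

@[simp]
theorem headMul_succ {n : ℕ} (a : S) (x : Fin (n + 1) → S) (i : Fin n) :
    headMul a x i.succ = x i.succ := rfl

theorem tail_headMul {n : ℕ} (a : S) (x : Fin (n + 1) → S) :
    Fin.tail (headMul a x) = Fin.tail x := rfl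

theorem init_headMul {n : ℕ} (a : S) (x : Fin (n + 2) → S) :
    Fin.init (headMul a x) = headMul a (Fin.init x) := by
  funext i
  cases i using Fin.cases with
  | zero => rfl
  | succ i => rfl

theorem init_cons {S : Type u} {n : ℕ} (a : S) (x : Fin (n + 1) → S) :
    Fin.init (Fin.cons a x : Fin (n + 2) → S) = Fin.cons a (Fin.init x) := by
  funext i
  cases i using Fin.cases with
  | zero => rfl
  | succ i => rfl

theorem contractNth_zero_cons {n : ℕ} (a : S) (x : Fin (n + 1) → S) :
    Fin.contractNth (0 : Fin (n + 2)) (· * ·) (Fin.cons a x : Fin (n + 2) → S) =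
      headMul a x := by
  funext i
  cases i using Fin.cases with
  | zero => simp [Fin.contractNth]
  | succ i => simp [Fin.contractNth]

theorem contractNth_succ_cons {n : ℕ} (k : Fin (n + 1)) (a : S) (x : Fin (n + 1) → S) :
    Fin.contractNth k.succ (· * ·) (Fin.cons a x : Fin (n + 2) → S) =
      Fin.cons a (Fin.contractNth k (· * ·) x) := by
  funext i
  cases i using Fin.cases with
  | zero => simp [Fin.contractNth]
  | succ i => simp [Fin.contractNth]

theorem contractNth_headMul {n : ℕ} (k : Fin (n + 2)) (a : S) (x : Fin (n + 2) → S) :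
    Fin.contractNth k (· * ·) (headMul a x) = headMul a (Fin.contractNth k (· * ·) x) := by
  funext i
  cases i using Fin.cases with
  | zero =>
    cases k using Fin.cases with
    | zero =>
      have h : headMul a x 1 = x 1 := rfl
      simp [Fin.contractNth, mul_assoc, h]
    | succ k => simp [Fin.contractNth]
  | succ i => simp [Fin.contractNth]

theorem coboundary_cons {n : ℕ} (f : Cochain S A (n + 1)) (a : S) (x : Fin (n + 1) → S) :
    coboundary ρ (n + 1) f (Fin.cons a x) = ρ a (f x) - f (headMul a x)
      + ∑ k : Fin n, (-1 : ℤ) ^ ((k : ℕ) + 2) • f (Fin.cons a (Fin.contractNth k.castSucc (· * ·) x))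
      + (-1 : ℤ) ^ (n + 2) • f (Fin.cons a (Fin.init x)) := by
  simp only [coboundary, AddMonoidHom.coe_mk, ZeroHom.coe_mk]
  rw [Fin.sum_univ_succ, init_cons]
  simp only [Fin.cons_zero, Fin.tail_cons, Fin.castSucc_zero, contractNth_zero_cons,
    Fin.castSucc_succ, contractNth_succ_cons, Fin.val_zero, Fin.val_succ]
  simp only [zero_add, pow_one, neg_smul, one_smul]
  abel

end General

/-! ### Vanishing above degree 1 for free semigroups. -/

section Free

variable {S : Type u} [Semigroup S] {A : Type v} [AddCommGroup A] (ρ : Action S A) {X : Type u}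
  (e : S ≃* FreeSemigroup X)

/-- Auxiliary recursion for `primitive`: the first argument is the word `a l`. -/
def primitiveAux {n : ℕ} (f : Cochain S A (n + 2)) (r : Fin n → S) : List X → X → A
  | [], _ => 0
  | b :: l, a => ρ (e.symm (.of a)) (primitiveAux f r l b)
      - f (Fin.cons (e.symm (.of a)) (Fin.cons (e.symm ⟨b, l⟩) r))

/-- The cochain `g` that vanishes if its first argument is a free generator, and that satisfies
`g (a w, …) = a g (w, …) - f (a, w, …)` for each free generator `a`. -/
def primitive {n : ℕ} (f : Cochain S A (n + 2)) : Cochain S A (n + 1) := fun x ↦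
  primitiveAux ρ e f (Fin.tail x) (e (x 0)).tail (e (x 0)).head

theorem primitive_eq_zero {n : ℕ} (f : Cochain S A (n + 2)) {x : Fin (n + 1) → S} {a : X}
    (h : x 0 = e.symm (.of a)) : primitive ρ e f x = 0 := by
  simp [primitive, h, FreeSemigroup.of, primitiveAux]

theorem primitive_headMul {n : ℕ} (f : Cochain S A (n + 2)) (a : X) (x : Fin (n + 1) → S) :
    primitive ρ e f (headMul (e.symm (.of a)) x) =
      ρ (e.symm (.of a)) (primitive ρ e f x) - f (Fin.cons (e.symm (.of a)) x) := by
  have h : e.symm ⟨(e (x 0)).head, (e (x 0)).tail⟩ = x 0 := e.symm_apply_apply _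
  simp [primitive, primitiveAux, tail_headMul, FreeSemigroup.of, h, Fin.cons_self_tail]

theorem apply_cons_eq {n : ℕ} (f : Cochain S A (n + 2)) (a : X) (x : Fin (n + 1) → S) :
    f (Fin.cons (e.symm (.of a)) x) = ρ (e.symm (.of a)) (primitive ρ e f x)
      - primitive ρ e f (headMul (e.symm (.of a)) x) := by
  rw [primitive_headMul]
  abel

/-- Induction on the length of the first word. For a generator, the definition of `primitive`
suffices; the cocycle identity passes from `w` to `a w`. -/
theorem coboundary_primitive {n : ℕ} {f : Cochain S A (n + 2)} (hf : coboundary ρ (n + 2) f = 0) :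
    coboundary ρ (n + 1) (primitive ρ e f) = f := by
  suffices h : ∀ (w : FreeSemigroup X) (x : Fin (n + 2) → S), x 0 = e.symm w →
      coboundary ρ (n + 1) (primitive ρ e f) x = f x by
    funext x
    exact h (e (x 0)) x (e.symm_apply_apply _).symm
  rintro ⟨a, l⟩
  induction l generalizing a with
  | nil =>
    intro x hx
    change x 0 = e.symm (.of a) at hx
    rw [← Fin.cons_self_tail x, hx, coboundary_cons, apply_cons_eq ρ e f a]
    have h₀ : ∀ y : Fin n → S, primitive ρ e f (Fin.cons (e.symm (.of a)) y) = 0 :=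
      fun y ↦ primitive_eq_zero ρ e f rfl
    simp [h₀]
  | cons b l ih =>
    intro x hx
    obtain ⟨y, rfl, hy⟩ : ∃ y : Fin (n + 2) → S, x = headMul (e.symm (.of a)) y ∧
        y 0 = e.symm ⟨b, l⟩ := by
      refine ⟨Fin.cons (e.symm ⟨b, l⟩) (Fin.tail x), ?_, rfl⟩
      rw [headMul, Fin.tail_cons, Fin.cons_zero, ← map_mul, FreeSemigroup.of_mul_mk, ← hx,
        Fin.cons_self_tail]
    have hc := congrFun hf (Fin.cons (e.symm (.of a)) y)
    rw [coboundary_cons, ← ih b y hy] at hc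
    simp only [apply_cons_eq ρ e f a] at hc
    simp only [coboundary, AddMonoidHom.coe_mk, ZeroHom.coe_mk, map_add, map_sum, map_zsmul,
      smul_sub, Finset.sum_sub_distrib, Pi.zero_apply, map_neg, pow_succ _ (_ + 1), mul_neg, mul_one,
      neg_smul, Finset.sum_neg_distrib] at hc ⊢
    simp only [contractNth_headMul, init_headMul, tail_headMul, headMul_zero, map_mul,
      AddMonoid.End.coe_mul, Function.comp_apply]
    rw [← sub_eq_zero, ← hc]
    abel

theorem cocycles_le_coboundaries (e : S ≃* FreeSemigroup X) (n : ℕ) :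
    cocycles ρ (n + 2) ≤ coboundaries ρ (n + 2) :=
  fun _ hf ↦ ⟨primitive ρ e _, coboundary_primitive ρ e hf⟩

end Free

/-- The action in which every element acts as the identity. -/
def trivialAction (S : Type u) [Semigroup S] (A : Type v) [AddCommGroup A] : Action S A where
  toFun _ := 1
  map_mul' _ _ := (mul_one 1).symm

/-- The length of words is a noncoboundary cocycle with trivial coefficients. -/
theorem nontrivial_H_one {S : Type u} [Semigroup S] [Nonempty S] {X : Type u}
    (e : S ≃* FreeSemigroup X) : Nontrivial (H (trivialAction S (ULift.{u} ℤ)) 1) := by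
  rw [nontrivial_H_iff]
  intro h
  let f : Cochain S (ULift.{u} ℤ) 1 := fun x ↦ ⟨((e (x 0)).length : ℤ)⟩
  have hf : f ∈ cocycles (trivialAction S (ULift.{u} ℤ)) 1 := by
    change coboundary _ 1 f = 0
    funext x
    simp [coboundary, trivialAction, f, Fin.contractNth, Fin.tail, Fin.init,
      FreeSemigroup.length_mul]
  obtain ⟨g, hg⟩ := h hf
  obtain ⟨s⟩ := ‹Nonempty S›
  -- With trivial action, coboundaries of 0-cochains vanish.
  have h₀ : f (fun _ ↦ s) = 0 := by
    rw [← hg]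
    simp [coboundary, trivialAction, Subsingleton.elim (Fin.tail fun _ ↦ s) (Fin.init fun _ ↦ s)]
  have h₁ := congrArg ULift.down h₀
  simp [f, FreeSemigroup.length] at h₁
  omega

theorem cohomologicalDimension_eq_one_of_isFree {S : Type u} [Semigroup S] [Nonempty S]
    (h : IsFree S) : cohomologicalDimension S = 1 := by
  obtain ⟨X, ⟨e⟩⟩ := h
  refine le_antisymm (iSup₂_le ?_) ?_
  · rintro n ⟨A, _, ρ, hn⟩
    match n with
    | 0 => simp
    | 1 => simp
    | n + 2 => exact absurd (cocycles_le_coboundaries ρ e n) ((nontrivial_H_iff ρ _).1 hn)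
  · exact le_iSup₂_of_le (f := fun (n : ℕ) _ ↦ (n : ℕ∞)) 1
      ⟨ULift.{u} ℤ, inferInstance, trivialAction S _, nontrivial_H_one e⟩ (by simp)

theorem cocycles_two_le_coboundaries {S : Type u} [Semigroup S]
    (h : cohomologicalDimension S = 1) {A : Type u} [AddCommGroup A] (ρ : Action S A) :
    cocycles ρ 2 ≤ coboundaries ρ 2 := by
  by_contra hn
  have h₂ : ((2 : ℕ) : ℕ∞) ≤ cohomologicalDimension S :=
    le_iSup₂_of_le (f := fun (n : ℕ) _ ↦ (n : ℕ∞)) 2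
      ⟨A, inferInstance, ρ, (nontrivial_H_iff ρ 2).2 hn⟩ le_rfl
  rw [h] at h₂
  exact absurd h₂ (by decide)

/-! ### From vanishing `H²` to left unitarity. -/

/-- The action of `S` on the free abelian group on `S` by left multiplication. -/
noncomputable def leftRegular (S : Type u) [Semigroup S] : Action S (S →₀ ℤ) where
  toFun s := Finsupp.mapDomain.addMonoidHom (s * ·)
  map_mul' s t := by
    ext x : 1
    change x.mapDomain (s * t * ·) = (x.mapDomain (t * ·)).mapDomain (s * ·)
    rw [← Finsupp.mapDomain_comp]
    simp [Function.comp_def, mul_assoc]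

theorem leftRegular_apply {S : Type u} [Semigroup S] (s : S) (p : S →₀ ℤ) :
    leftRegular S s p = p.mapDomain (s * ·) := rfl

/-- If the second cohomology vanishes, then a function that is invariant under right
multiplication gives rise to a trivial 2-cocycle in the regular module. -/
theorem exists_primitive_of_right_invariant {S : Type u} [Semigroup S]
    (h : cohomologicalDimension S = 1) (c : S → ℤ) (hc : ∀ x y, c (x * y) = c x) :
    ∃ g : S → S →₀ ℤ, ∀ x y,
      (g y).mapDomain (x * ·) - g (x * y) + g x = Finsupp.single x (c y) := by
  let f : Cochain S (S →₀ ℤ) 2 := fun x ↦ Finsupp.single (x 0) (c (x 1))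
  have hf : f ∈ cocycles (leftRegular S) 2 := by
    change coboundary _ 2 f = 0
    funext x
    simp [coboundary, leftRegular_apply, f, Fin.contractNth, Fin.tail, Fin.init,
      Fin.sum_univ_two, hc]
  obtain ⟨g, hg⟩ := cocycles_two_le_coboundaries h (leftRegular S) hf
  refine ⟨fun s ↦ g fun _ ↦ s, fun x y ↦ ?_⟩
  have h₁ := congrFun hg ![x, y]
  have e₁ : Fin.tail ![x, y] = fun _ ↦ y := by ext i; fin_cases i; rfl
  have e₂ : Fin.init ![x, y] = fun _ ↦ x := by ext i; fin_cases i; rfl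
  have e₃ : Fin.contractNth 0 (· * ·) ![x, y] = fun _ ↦ x * y := by ext i; fin_cases i; rfl
  simp [coboundary, leftRegular_apply, f, e₁, e₂, e₃] at h₁
  rw [← h₁]
  abel

end SemigroupCohomology

namespace SemigroupIdeal

open SemigroupCohomology

variable {α : Type u} (L : SemigroupIdeal (FreeSemigroup α))

/-- A left ideal of cohomological dimension one is left unitary. -/
theorem mem_of_mul_mem [Nontrivial α] (h : cohomologicalDimension L.toSubsemigroup = 1)
    {x u : FreeSemigroup α} (hx : x ∈ L) (hxu : x * u ∈ L) : u ∈ L := by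
  classical
  by_contra hu
  obtain ⟨a, b, hab⟩ := exists_pair_ne α
  let c : L.toSubsemigroup → ℤ := fun y ↦ if y.1.head = a then 1 else 0
  obtain ⟨g, hg⟩ := exists_primitive_of_right_invariant h c fun y z ↦ rfl
  let x' : L.toSubsemigroup := ⟨x, hx⟩
  let w : L.toSubsemigroup := ⟨x * u, hxu⟩
  have hne : x' ≠ w := by
    intro hxw
    have h₁ : x.length = (x * u).length :=
      congrArg FreeSemigroup.length (congrArg Subtype.val hxw)
    rw [FreeSemigroup.length_mul] at h₁
    have := u.length_pos
    omega
  have key : ∀ t : L.toSubsemigroup, c t = g w w - g x' w := by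
    intro t
    let v : L.toSubsemigroup := ⟨u * t.1, L.mul_mem u t.2⟩
    have hv : x' * v = w * t := Subtype.ext (mul_assoc x u t.1).symm
    have h₁ := DFunLike.congr_fun (hg x' v) w
    have h₂ := DFunLike.congr_fun (hg w t) w
    -- By cancellation, `w = x' * y` would force `y = u ∉ L`.
    have m₁ : (g v).mapDomain (x' * ·) w = 0 := by
      apply Finsupp.mapDomain_of_notMem_range
      rintro ⟨y, hy⟩
      have hyu : y.1 = u := FreeSemigroup.mul_left_cancel' (congrArg Subtype.val hy)
      exact hu (hyu ▸ y.2)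
    have m₂ : (g t).mapDomain (w * ·) w = 0 := by
      apply Finsupp.mapDomain_of_notMem_range
      rintro ⟨y, hy⟩
      have h₁ : (w.1 * y.1).length = w.1.length :=
        congrArg FreeSemigroup.length (congrArg Subtype.val hy)
      rw [FreeSemigroup.length_mul] at h₁
      have := y.1.length_pos
      omega
    simp only [Finsupp.add_apply, Finsupp.sub_apply, m₁, m₂, hv, Finsupp.single_eq_same,
      Finsupp.single_eq_of_ne hne.symm] at h₁ h₂
    linarith
  -- `key` makes `c` constant, but it is 1 at `a x` and 0 at `b x`.
  have ha := key ⟨.of a * x, L.mul_mem _ hx⟩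
  have hb := key ⟨.of b * x, L.mul_mem _ hx⟩
  rw [← hb] at ha
  simp [c, FreeSemigroup.of, hab.symm] at ha

/-! ### Freeness of left unitary left ideals. -/

/-- The elements of a left ideal that are not products of two elements of the ideal. -/
def irreducibles : Set L.toSubsemigroup := {x | ∀ y z, x ≠ y * z}

/-- The canonical homomorphism from the free semigroup on the irreducible elements. -/
def liftIrreducibles : FreeSemigroup L.irreducibles →ₙ* L.toSubsemigroup :=
  FreeSemigroup.lift Subtype.val

theorem liftIrreducibles_surjective : Function.Surjective L.liftIrreducibles := by
  intro x
  induction hn : x.1.length using Nat.strong_induction_on generalizing x with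
  | _ n ih =>
    by_cases hx : x ∈ L.irreducibles
    · exact ⟨.of ⟨x, hx⟩, rfl⟩
    · simp only [irreducibles, Set.mem_ofPred_eq, not_forall, not_not] at hx
      obtain ⟨y, z, rfl⟩ := hx
      rw [MulMemClass.coe_mul, FreeSemigroup.length_mul] at hn
      have hy := y.1.length_pos
      have hz := z.1.length_pos
      obtain ⟨p, rfl⟩ := ih _ (by omega) y rfl
      obtain ⟨q, rfl⟩ := ih _ (by omega) z rfl
      exact ⟨p * q, map_mul _ _ _⟩

/-- Otherwise, by Levi's lemma, one of `a`, `b` is the other times some `u`; unitarity puts `u` in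
`L`, against irreducibility. -/
theorem eq_of_irreducible_mul_eq (h : ∀ x u, x ∈ L → x * u ∈ L → u ∈ L)
    {a b y z : L.toSubsemigroup} (ha : a ∈ L.irreducibles) (hb : b ∈ L.irreducibles)
    (hab : a * y = b * z) : a = b ∧ y = z := by
  rcases FreeSemigroup.equidivisible (congrArg Subtype.val hab) with
    ⟨h₁, h₂⟩ | ⟨u, h₁, -⟩ | ⟨u, h₁, -⟩
  · exact ⟨Subtype.ext h₁, Subtype.ext h₂⟩
  · exact absurd (Subtype.ext h₁) (hb a ⟨u, h a.1 u a.2 (h₁ ▸ b.2)⟩)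
  · exact absurd (Subtype.ext h₁) (ha b ⟨u, h b.1 u b.2 (h₁ ▸ a.2)⟩)

theorem liftIrreducibles_injective (h : ∀ x u, x ∈ L → x * u ∈ L → u ∈ L) :
    Function.Injective L.liftIrreducibles := by
  rintro ⟨a, l⟩
  induction l generalizing a with
  | nil =>
    rintro ⟨b, _ | ⟨c, m⟩⟩ hab
    · exact congrArg FreeSemigroup.of (Subtype.ext hab)
    · rw [← FreeSemigroup.of_mul_mk, map_mul] at hab
      exact absurd hab (a.2 _ _)
  | cons d l ih =>
    rintro ⟨b, _ | ⟨c, m⟩⟩ hab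
    · rw [← FreeSemigroup.of_mul_mk, map_mul] at hab
      exact absurd hab.symm (b.2 _ _)
    · rw [← FreeSemigroup.of_mul_mk, ← FreeSemigroup.of_mul_mk, map_mul, map_mul] at hab
      obtain ⟨h₁, h₂⟩ := L.eq_of_irreducible_mul_eq h a.2 b.2 hab
      rw [← FreeSemigroup.of_mul_mk, ← FreeSemigroup.of_mul_mk, Subtype.ext h₁, ih _ h₂]

/-- A left unitary left ideal of a free semigroup is free. -/
theorem isFree_of_leftUnitary (h : ∀ x u, x ∈ L → x * u ∈ L → u ∈ L) :
    IsFree L.toSubsemigroup :=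
  ⟨L.irreducibles, ⟨(MulEquiv.ofBijective L.liftIrreducibles
    ⟨L.liftIrreducibles_injective h, L.liftIrreducibles_surjective⟩).symm⟩⟩

end SemigroupIdeal

theorem proposition4 {α : Type u} [Nontrivial α] (L : SemigroupIdeal (FreeSemigroup α))
    (hL : (L : Set (FreeSemigroup α)).Nonempty) :
    SemigroupCohomology.cohomologicalDimension L.toSubsemigroup = 1 ↔
      SemigroupCohomology.IsFree L.toSubsemigroup := by
  have : Nonempty L.toSubsemigroup := hL.to_subtype
  exact ⟨fun h ↦ L.isFree_of_leftUnitary fun _ _ ↦ L.mem_of_mul_mem h,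
    SemigroupCohomology.cohomologicalDimension_eq_one_of_isFree⟩
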